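/- Let $N,m\ge 1$ be coprime. A twisted polygon in $\mathbb R^m$ with monodromy $M\in \mathrm{GL}(m,\mathbb R)$ is a sequence $\gamma=(\gamma_n)_{n\in\mathbb Z}$ in $\mathbb R^m$ with $\gamma_{n+N}=M\gamma_n$; for fixed $M$ the polygons form the space $(\mathbb R^m)^N$. Put $\rho_n=(\gamma_n,\gamma_{n+1},\dots,\gamma_{n+m-1})$, $\mathbf d_n=\det\rho_n$, and for a vector field $X$ on the space of polygons (extended by $X_{n+N}=MX_n$) put $\theta_n(X)=\det(X_n,\gamma_{n+1},\dots,\gamma_{n+m-1})$. Let $$\omega_2(X,Y)=\sum_{n=0}^{N-1}\frac1{\mathbf d_n}\Big[Y\theta_n(X)-X\theta_n(Y)-\theta_n([Y,X])+\frac1{\mathbf d_n}\big(\theta_n(Y)X(\mathbf d_n)-\theta_n(X)Y(\mathbf d_n)\big)\Big].$$ Let $\gamma$ be non-degenerate, i.e. $\mathbf d_n\ne0$ for all $n$. Then there are unique $N$-periodic sequences $a^0,\dots,a^{m-1}$ such that $D\gamma=0$ for $D=\sum_{k=0}^{m-1}a^k\mathcal T^k-\mathcal T^m$, where $(\mathcal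 T u)_n=u_{n+1}$; here $a^0$ is an arbitrary nowhere vanishing sequence, not normalized to a constant. Let $\mathcal F,\mathcal G$ be real functionals of operators $\sum_{k=0}^m a^k\mathcal T^k$ with $N$-periodic coefficients, of class $C^2$ near $D$, and let $$\delta_D\mathcal F=\sum_{k=0}^m\mathcal T^{-k}\,\delta_{a^k}\mathcal F,\qquad (\delta_{a^k}\mathcal F)_n=\frac{\partial\mathcal F}{\partial a^k_n}.$$ For an operator $L=\sum_i l^i\mathcal T^i$ let $L_+$, $L_0$, $L_-$ be its parts of strictly positive, zero and strictly negative order, $r(L)=\frac12(L_+-L_-)$ and $\mathrm{Tr}(L)=l^0$. Let $$\{\mathcal F,\mathcal G\}_2(D)=\sum_{n=0}^{N-1}\mathrm{Tr}\Big(\big[D_0\big((\delta_D\mathcal F)_-D_+\big)_+-\big(D_+(\delta_D\mathcal F)_-\big)_+D_0\big]\,\delta_D\mathcal G\Big)(n),$$ and let $X^f=r(\delta_D\mathcal F\,D)(\gamma)$, $X^g=r(\delta_D\mathcal G\,D)(\gamma)$ be the polygonal vector fields associated with $\mathcal F$ and $\mathcal G$ (with $D$ the operator determined by $\gamma$). Then,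 at every non-degenerate polygon $\gamma$: 1. $\omega_2$ is the exact form $\sum_n d(\theta_n/\mathbf d_n)$: for all polygonal vector fields $X,Y$ differentiable at $\gamma$, $\omega_2(X,Y)=d\alpha(Y,X)$, where $\alpha=\sum_{n=0}^{N-1}\theta_n/\mathbf d_n$ and $d\alpha(Y,X)=Y\alpha(X)-X\alpha(Y)-\alpha([Y,X])$. 2. $X^f$ lifts the Hamiltonian evolution $D_t=r(D\,\delta_D\mathcal F)D-D\,r(\delta_D\mathcal F\,D)$ of $D$ to polygons: $D(X^f)=-D_t(\gamma)$. 3. The companion bracket satisfies $$\{\mathcal F,\mathcal G\}_2(D)=-\,\omega_2(X^g,X^f)=\omega_2(X^f,X^g).$$ -/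

import Mathlib

open scoped Matrix

noncomputable section

namespace DiscreteW

/-! ### Difference operators with `N`-periodic coefficients -/

/-- A difference operator `∑ i, u i 𝒯 ^ i` with finitely many terms (negative powers of the shift
`𝒯` are allowed). The coefficients are `N`-periodic sequences, i.e. functions on `ℤ/N`. -/
abbrev DiffOp (N : ℕ) : Type := ℤ →₀ (ZMod N → ℝ)

namespace DiffOp

variable {N : ℕ}

/-- Composition of operators, where `(𝒯 v) n = v (n + 1)`; hence
`(u 𝒯 ^ i) (v 𝒯 ^ j) = u (𝒯 ^ i v) 𝒯 ^ (i + j)`. -/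
def comp (U V : DiffOp N) : DiffOp N :=
  U.sum fun i u => V.sum fun j v => Finsupp.single (i + j) fun n => u n * v (n + (i : ZMod N))

/-- The strictly positive part `L₊`. -/
def pos (L : DiffOp N) : DiffOp N := L.filter fun i => 0 < i

/-- The strictly negative part `L₋`. -/
def neg (L : DiffOp N) : DiffOp N := L.filter fun i => i < 0

/-- The part of order zero `L₀`. -/
def zero (L : DiffOp N) : DiffOp N := L.filter fun i => i = 0

/-- `Tr L` is the sequence of coefficients of `𝒯 ^ 0`. -/
def tr (L : DiffOp N) : ZMod N → ℝ := L 0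

/-- The classical `r`-operator `r(L) = (L₊ - L₋) / 2`. -/
def r (L : DiffOp N) : DiffOp N := (1 / 2 : ℝ) • (L.pos - L.neg)

/-- The action on bi-infinite sequences of vectors: `(L γ) n = ∑ i, (u i) n • γ (n + i)`. -/
def act {m : ℕ} (L : DiffOp N) (γ : ℤ → Fin m → ℝ) (n : ℤ) : Fin m → ℝ :=
  L.sum fun i u => u (n : ZMod N) • γ (n + i)

end DiffOp

/-- The coefficients `(a ^ 0, …, a ^ m)` of an operator of order at most `m`: coordinates on
`DO(N, m)`. -/
abbrev Coeffs (N m : ℕ) : Type := Fin (m + 1) → ZMod N → ℝ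

/-- `D = ∑ k ≤ m, a ^ k 𝒯 ^ k`. -/
def opOf {N m : ℕ} (a : Coeffs N m) : DiffOp N :=
  ∑ k : Fin (m + 1), Finsupp.single (k : ℤ) (a k)

section Brackets

variable {N m : ℕ} [NeZero N]

/-- `δ_{a ^ k} F`, the sequence of the partial derivatives of `F` with respect to `a ^ k n`. -/
def partialVar (F : Coeffs N m → ℝ) (a : Coeffs N m) (k : Fin (m + 1)) (n : ZMod N) : ℝ :=
  fderiv ℝ F a (Pi.single k (Pi.single n 1))

/-- The variational derivative `δ_D F = ∑ k ≤ m, 𝒯 ^ (-k) δ_{a ^ k} F`; it represents the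
differential of `F` through the pairing `⟨V, W⟩ = ∑ n, Tr (V W) n`. -/
def varDeriv (F : Coeffs N m → ℝ) (a : Coeffs N m) : DiffOp N :=
  ∑ k : Fin (m + 1),
    DiffOp.comp (Finsupp.single (-(k : ℤ)) 1) (Finsupp.single 0 (partialVar F a k))

/-- The right-hand side `r(D δF) D - D r(δF D)` of the Hamiltonian evolution `D_t` of `D` for the
quadratic bracket `{F, G}₁ = ∑ n, Tr ((r(D δF) D - D r(δF D)) δG) n`. -/
def hamOp (F : Coeffs N m → ℝ) (a : Coeffs N m) : DiffOp N :=
  (((opOf a).comp (varDeriv F a)).r).comp (opOf a)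
    - (opOf a).comp (((varDeriv F a).comp (opOf a)).r)

/-- The companion bracket
`{F, G}₂ = ∑ n, Tr ((D₀ ((δF)₋ D₊)₊ - (D₊ (δF)₋)₊ D₀) δG) n`. -/
def bracket₂ (F G : Coeffs N m → ℝ) (a : Coeffs N m) : ℝ :=
  ∑ n : ZMod N, DiffOp.tr
    (DiffOp.comp
      ((opOf a).zero.comp ((varDeriv F a).neg.comp (opOf a).pos).pos
        - (((opOf a).pos.comp (varDeriv F a).neg).pos).comp (opOf a).zero)
      (varDeriv G a)) n

end Brackets

/-! ### Twisted polygons in `ℝ ^ m` -/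

/-- The `N` vertices `γ 0, …, γ (N - 1)` of a twisted polygon in `ℝ ^ m`; also the tangent vectors
to the space of twisted polygons with a fixed monodromy. -/
abbrev Polygon (N m : ℕ) : Type := ZMod N → Fin m → ℝ

section Polygons

variable {N m : ℕ}

/-- The bi-infinite sequence with `γ (n + N) = M (γ n)` whose vertices over `0 ≤ n < N` are
given by `p`. -/
def twist (M : GL (Fin m) ℝ) (p : Polygon N m) (n : ℤ) : Fin m → ℝ :=
  ((M ^ (n / (N : ℤ)) : GL (Fin m) ℝ) : Matrix (Fin m) (Fin m) ℝ) *ᵥ p (n : ZMod N)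

/-- The matrix `ρ n` with columns `γ n, γ (n + 1), …, γ (n + m - 1)`. -/
def rho (M : GL (Fin m) ℝ) (n : ℤ) (p : Polygon N m) : Matrix (Fin m) (Fin m) ℝ :=
  Matrix.of fun i j => twist M p (n + (j : ℤ)) i

/-- `𝐝 n = det (ρ n)`. -/
def dd (M : GL (Fin m) ℝ) (n : ℤ) (p : Polygon N m) : ℝ := (rho M n p).det

/-- Any `m` consecutive vertices are linearly independent. -/
def Nondegenerate (M : GL (Fin m) ℝ) (p : Polygon N m) : Prop := ∀ n : ℤ, dd M n p ≠ 0

/-- The invariants of a polygon: the coefficients of the operator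
`D = a ^ 0 + a ^ 1 𝒯 + ⋯ + a ^ (m - 1) 𝒯 ^ (m - 1) - 𝒯 ^ m` with `D γ = 0`. For `k < m`, the
sequence `a ^ k` consists of the `k`-th coordinates of `γ (n + m)` in the basis `ρ n`. -/
def invariants (M : GL (Fin m) ℝ) (p : Polygon N m) : Coeffs N m :=
  Fin.snoc (α := fun _ => ZMod N → ℝ)
    (fun (k : Fin m) (n : ZMod N) =>
      ((rho M (n.val : ℤ) p)⁻¹ *ᵥ twist M p ((n.val : ℤ) + (m : ℤ))) k)
    (fun _ => -1)

/-- `θ n (X) = det (X n, γ (n + 1), …, γ (n + m - 1))`, a one-form on polygons. -/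
def theta [NeZero m] (M : GL (Fin m) ℝ) (n : ℤ) (p : Polygon N m) : Polygon N m →ₗ[ℝ] ℝ where
  toFun X := ((rho M n p).updateCol 0 (twist M X n)).det
  map_add' X Y := by
    simp only [twist, Pi.add_apply, Matrix.mulVec_add, Matrix.det_updateCol_add]
  map_smul' c X := by
    simp only [twist, Pi.smul_apply, Matrix.mulVec_smul, Matrix.det_updateCol_smul,
      RingHom.id_apply, smul_eq_mul]

variable [NeZero N]

/-- The one-form `∑ n, θ n / 𝐝 n` on polygons. -/
def thetaForm [NeZero m] (M : GL (Fin m) ℝ) (p : Polygon N m) : Polygon N m [⋀^Fin 1]→L[ℝ] ℝ :=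
  ContinuousAlternatingMap.ofSubsingleton ℝ (Polygon N m) ℝ (0 : Fin 1)
    (LinearMap.toContinuousLinearMap
      (∑ n ∈ Finset.range N, (1 / dd M (n : ℤ) p) • theta M (n : ℤ) p))

/-- The two-form `ω₂ = ∑ n, d (θ n / 𝐝 n)` evaluated on two polygonal vector fields. -/
def omega₂ [NeZero m] (M : GL (Fin m) ℝ) (X Y : Polygon N m → Polygon N m) (p : Polygon N m) : ℝ :=
  ∑ n ∈ Finset.range N, 1 / dd M (n : ℤ) p *
    (fderiv ℝ (fun q => theta M (n : ℤ) q (X q)) p (Y p)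
      - fderiv ℝ (fun q => theta M (n : ℤ) q (Y q)) p (X p)
      - theta M (n : ℤ) p (VectorField.lieBracket ℝ Y X p)
      + 1 / dd M (n : ℤ) p *
        (theta M (n : ℤ) p (Y p) * fderiv ℝ (dd M (n : ℤ)) p (X p)
          - theta M (n : ℤ) p (X p) * fderiv ℝ (dd M (n : ℤ)) p (Y p)))

/-- The polygonal vector field `r(δF D) (γ)`, where `D γ = 0`, that lifts the Hamiltonian
evolution of `D` with Hamiltonian `F`. -/
def hamField (M : GL (Fin m) ℝ) (F : Coeffs N m → ℝ) (p : Polygon N m) : Polygon N m :=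
  fun n => (((varDeriv F (invariants M p)).comp (opOf (invariants M p))).r).act
    (twist M p) (n.val : ℤ)

end Polygons

end DiscreteW

end

/-!
The three claims rest on the following observations.

**`ω₂` is tensorial and exact.** The determinant is multilinear in the columns of a frame, so
`Y θ n (X)` is `θ n (D_Y X)` plus the sum `thetaDeriv` of the determinants in which `γ n` is
replaced by `X n` and one other column by `Y` (`fderiv_theta`). The terms with derivatives of `X`
and `Y` cancel against `θ n ([Y, X])`, and what is left is both an expression in the values `X p`, `Y p`
(`omega₂_eq`) and the exterior derivative of `∑ n, θ n / 𝐝 n` (`omega₂_eq_extDeriv`).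

**The lift.** Composition of operators acts on sequences as composition (`comp_act`), a twisted
polygon is killed by its operator `D` (`invariants_act`), and operators with periodic coefficients
preserve the twist (`twist_act`). Hence `D_t γ = -D r(δF D) γ`, which is `opOf_act_hamField`.

**The bracket.** Write `P = δF`, `Q = δG`, `B = (P₋ D₊)₊`, `C = (Q₋ D₊)₊`; the last two have orders
between `1` and `m - 1`. Because `D γ = 0`, the field `r(P D) γ` equals `B γ` up to a field
`n ↦ e n • γ n` (`r_comp_act`). For fields `X = U γ`, `Y = V γ` given by operators of orders
between `0` and `m - 1`, the two-column determinants in `ω₂` collapse: `ω₂ (X, Y)` is the sum over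
`n` of the coordinates of `((V U - U V) γ) n` along `γ n` in the basis `γ n, …, γ (n + m - 1)`
(`omega₂_act`). Finally `B C - (B Q₋)_{≥ 0} D` has orders between `0` and `m - 1`, and its term of
order zero is `-(B Q₋)₀ D₀` (`exists_liftOp_reduction`), so the coordinate of `(B C γ) n` along
`γ n` is `-Tr (B Q₋ D₀) n`, while the scalings `e` contribute symmetrically and cancel. Therefore
`ω₂ (X^f, X^g) = ∑ n, Tr (B Q₋ D₀ - C P₋ D₀) n`, and the cyclicity of the trace turns the companion
bracket into the same expression (`sum_tr_companion`).
-/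

open scoped Matrix

noncomputable section

namespace DiscreteW

namespace DiffOp

/-! ### The algebra of difference operators -/

variable {N : ℕ}

lemma comp_add (U V W : DiffOp N) : U.comp (V + W) = U.comp V + U.comp W := by
  unfold comp
  rw [← Finsupp.sum_add]
  refine Finsupp.sum_congr fun i _ => ?_
  refine Finsupp.sum_add_index' (fun j => ?_) (fun j v w => ?_)
  · simp only [Pi.zero_apply, mul_zero]
    exact Finsupp.single_zero _
  · rw [← Finsupp.single_add]
    congr 1
    funext n
    simp [mul_add]

lemma add_comp (U V W : DiffOp N) : (U + V).comp W = U.comp W + V.comp W := by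
  unfold comp
  refine Finsupp.sum_add_index' (fun i => ?_) (fun i u v => ?_)
  · refine Finset.sum_eq_zero fun j _ => ?_
    simp only [Pi.zero_apply, zero_mul]
    exact Finsupp.single_zero _
  · rw [← Finsupp.sum_add]
    refine Finsupp.sum_congr fun j _ => ?_
    rw [← Finsupp.single_add]
    congr 1
    funext n
    simp [add_mul]

lemma zero_comp (U : DiffOp N) : (0 : DiffOp N).comp U = 0 := by simp [comp]

lemma comp_zero (U : DiffOp N) : U.comp 0 = 0 := by simp [comp]

lemma neg_comp (U V : DiffOp N) : (-U).comp V = -U.comp V := by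
  rw [eq_neg_iff_add_eq_zero, ← add_comp, neg_add_cancel, zero_comp]

lemma comp_neg (U V : DiffOp N) : U.comp (-V) = -U.comp V := by
  rw [eq_neg_iff_add_eq_zero, ← comp_add, neg_add_cancel, comp_zero]

lemma sub_comp (U V W : DiffOp N) : (U - V).comp W = U.comp W - V.comp W := by
  rw [sub_eq_add_neg, add_comp, neg_comp, sub_eq_add_neg]

lemma comp_sub (U V W : DiffOp N) : U.comp (V - W) = U.comp V - U.comp W := by
  rw [sub_eq_add_neg, comp_add, comp_neg, sub_eq_add_neg]

lemma single_comp_single (i j : ℤ) (u v : ZMod N → ℝ) :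
    comp (Finsupp.single i u) (Finsupp.single j v)
      = Finsupp.single (i + j) fun n => u n * v (n + (i : ZMod N)) := by
  unfold comp
  rw [Finsupp.sum_single_index, Finsupp.sum_single_index]
  · simp only [Pi.zero_apply, mul_zero]
    exact Finsupp.single_zero _
  · refine Finset.sum_eq_zero fun j _ => ?_
    simp only [Pi.zero_apply, zero_mul]
    exact Finsupp.single_zero _

lemma comp_assoc (U V W : DiffOp N) : (U.comp V).comp W = U.comp (V.comp W) := by
  induction U using Finsupp.induction_linear with
  | zero => simp only [zero_comp]
  | add U U' h h' => simp only [add_comp, h, h']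
  | single i u =>
    induction V using Finsupp.induction_linear with
    | zero => simp only [zero_comp, comp_zero]
    | add V V' h h' => simp only [comp_add, add_comp, h, h']
    | single j v =>
      induction W using Finsupp.induction_linear with
      | zero => simp only [comp_zero]
      | add W W' h h' => simp only [comp_add, h, h']
      | single k w =>
        simp only [single_comp_single]
        rw [add_assoc]
        congr 1
        funext n
        push_cast
        rw [mul_assoc, add_assoc]

/-! ### Orders of operators -/

/-- All terms of `L` have order between `a` and `b`. -/
def OrderIn (L : DiffOp N) (a b : ℤ) : Prop := ∀ i, L i ≠ 0 → a ≤ i ∧ i ≤ b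

lemma OrderIn.mono {L : DiffOp N} {a b c d : ℤ} (h : L.OrderIn a b) (hc : c ≤ a) (hd : b ≤ d) :
    L.OrderIn c d := fun i hi => ⟨hc.trans (h i hi).1, (h i hi).2.trans hd⟩

lemma OrderIn.apply_eq_zero {L : DiffOp N} {a b i : ℤ} (h : L.OrderIn a b)
    (hi : i < a ∨ b < i) : L i = 0 := by
  by_contra hne
  have := h i hne
  omega

lemma OrderIn.inter {L : DiffOp N} {a b c d : ℤ} (h : L.OrderIn a b) (h' : L.OrderIn c d) :
    L.OrderIn a d := fun i hi => ⟨(h i hi).1, (h' i hi).2⟩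

lemma OrderIn.add {L L' : DiffOp N} {a b : ℤ} (h : L.OrderIn a b) (h' : L'.OrderIn a b) :
    (L + L').OrderIn a b := by
  intro i hi
  by_cases h0 : L i = 0
  · refine h' i fun h1 => hi ?_
    rw [Finsupp.add_apply, h0, h1, add_zero]
  · exact h i h0

lemma OrderIn.negate {L : DiffOp N} {a b : ℤ} (h : L.OrderIn a b) : (-L).OrderIn a b := by
  intro i hi
  exact h i (by simpa using hi)

lemma OrderIn.sub {L L' : DiffOp N} {a b : ℤ} (h : L.OrderIn a b) (h' : L'.OrderIn a b) :
    (L - L').OrderIn a b := by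
  rw [sub_eq_add_neg]
  exact h.add h'.negate

lemma orderIn_zero (a b : ℤ) : (0 : DiffOp N).OrderIn a b := fun _ hi => absurd rfl hi

lemma orderIn_single (i : ℤ) (u : ZMod N → ℝ) : OrderIn (Finsupp.single i u) i i := by
  intro j hj
  rw [Finsupp.single_apply] at hj
  split_ifs at hj with h
  · exact ⟨h.le, h.ge⟩
  · exact absurd rfl hj

lemma orderIn_sum {ι : Type*} (s : Finset ι) (f : ι → DiffOp N) {a b : ℤ}
    (h : ∀ i ∈ s, (f i).OrderIn a b) : (∑ i ∈ s, f i).OrderIn a b :=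
  Finset.sum_induction f (fun L => L.OrderIn a b) (fun _ _ => OrderIn.add) (orderIn_zero a b) h

lemma OrderIn.comp {U V : DiffOp N} {a b c d : ℤ} (hU : U.OrderIn a b) (hV : V.OrderIn c d) :
    (U.comp V).OrderIn (a + c) (b + d) := by
  refine orderIn_sum _ _ fun i hi => orderIn_sum _ _ fun j hj => ?_
  have h1 := hU i (Finsupp.mem_support_iff.mp hi)
  have h2 := hV j (Finsupp.mem_support_iff.mp hj)
  exact (orderIn_single (i + j) _).mono (by omega) (by omega)

lemma pos_apply (L : DiffOp N) (i : ℤ) : L.pos i = if 0 < i then L i else 0 := by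
  rw [pos, Finsupp.filter_apply]

lemma neg_apply (L : DiffOp N) (i : ℤ) : L.neg i = if i < 0 then L i else 0 := by
  rw [neg, Finsupp.filter_apply]

lemma zero_apply (L : DiffOp N) (i : ℤ) : L.zero i = if i = 0 then L i else 0 := by
  rw [zero, Finsupp.filter_apply]

lemma pos_add_zero_add_neg (L : DiffOp N) : L.pos + L.zero + L.neg = L := by
  ext1 i
  simp only [Finsupp.add_apply, pos_apply, zero_apply, neg_apply]
  rcases lt_trichotomy i 0 with h | h | h
  · simp [h, h.ne, h.le.not_gt]
  · simp [h]
  · simp [h, h.ne', h.le.not_gt]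

lemma pos_add (L L' : DiffOp N) : (L + L').pos = L.pos + L'.pos := Finsupp.filter_add

lemma neg_add (L L' : DiffOp N) : (L + L').neg = L.neg + L'.neg := Finsupp.filter_add

lemma zero_eq_single (L : DiffOp N) : L.zero = Finsupp.single 0 (L 0) := by
  ext1 i
  rw [zero_apply, Finsupp.single_apply]
  by_cases h : i = 0
  · subst h; simp
  · simp [h, Ne.symm h]

lemma orderIn_zeroPart (L : DiffOp N) : L.zero.OrderIn 0 0 := by
  rw [zero_eq_single]
  exact orderIn_single 0 _

lemma OrderIn.pos {L : DiffOp N} {a b : ℤ} (h : L.OrderIn a b) : L.pos.OrderIn 1 b := by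
  intro i hi
  rw [pos_apply] at hi
  split_ifs at hi with h0
  · exact ⟨h0, (h i hi).2⟩
  · exact absurd rfl hi

lemma OrderIn.neg {L : DiffOp N} {a b : ℤ} (h : L.OrderIn a b) : L.neg.OrderIn a (-1) := by
  intro i hi
  rw [neg_apply] at hi
  split_ifs at hi with h0
  · exact ⟨(h i hi).1, by omega⟩
  · exact absurd rfl hi

lemma OrderIn.pos_eq_self {L : DiffOp N} {a b : ℤ} (h : L.OrderIn a b) (ha : 0 < a) :
    L.pos = L := by
  ext1 i
  rw [pos_apply]
  split_ifs with h0
  · rfl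
  · exact (h.apply_eq_zero (by omega)).symm

lemma OrderIn.pos_eq_zero {L : DiffOp N} {a b : ℤ} (h : L.OrderIn a b) (hb : b ≤ 0) :
    L.pos = 0 := by
  ext1 i
  rw [pos_apply]
  split_ifs with h0
  · exact h.apply_eq_zero (by omega)
  · rfl

lemma OrderIn.neg_eq_zero {L : DiffOp N} {a b : ℤ} (h : L.OrderIn a b) (ha : 0 ≤ a) :
    L.neg = 0 := by
  ext1 i
  rw [neg_apply]
  split_ifs with h0
  · exact h.apply_eq_zero (by omega)
  · rfl

/-! ### Trace -/

lemma tr_add (U V : DiffOp N) : (U + V).tr = U.tr + V.tr := rfl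

lemma tr_sub (U V : DiffOp N) : (U - V).tr = U.tr - V.tr := rfl

lemma OrderIn.tr_eq_zero {L : DiffOp N} {a b : ℤ} (h : L.OrderIn a b) (hab : 0 < a ∨ b < 0) :
    L.tr = 0 := h.apply_eq_zero hab

/-- Cyclicity of the trace: summed over a period, `Tr (U V)` and `Tr (V U)` agree. -/
lemma sum_tr_comp_comm [NeZero N] (U V : DiffOp N) :
    ∑ n, (U.comp V).tr n = ∑ n, (V.comp U).tr n := by
  induction U using Finsupp.induction_linear with
  | zero => simp only [zero_comp, comp_zero]
  | add U U' h h' =>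
    simp only [add_comp, comp_add, tr_add, Pi.add_apply, Finset.sum_add_distrib, h, h']
  | single i u =>
    induction V using Finsupp.induction_linear with
    | zero => simp only [zero_comp, comp_zero]
    | add V V' h h' =>
      simp only [add_comp, comp_add, tr_add, Pi.add_apply, Finset.sum_add_distrib, h, h']
    | single j v =>
      simp only [single_comp_single, tr]
      by_cases hij : i + j = 0
      · have hj : j = -i := by omega
        subst hj
        simp only [add_neg_cancel, neg_add_cancel, Finsupp.single_eq_same]
        refine Fintype.sum_equiv (Equiv.addRight (i : ZMod N)) _ _ fun n => ?_
        simp [mul_comm]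
      · rw [Finsupp.single_eq_of_ne (Ne.symm hij),
          Finsupp.single_eq_of_ne (by omega)]

lemma tr_comp_single_zero (U : DiffOp N) (v : ZMod N → ℝ) (n : ZMod N) :
    (U.comp (Finsupp.single 0 v)).tr n = U.tr n * v n := by
  induction U using Finsupp.induction_linear with
  | zero => simp [zero_comp, tr]
  | add U U' h h' => simp only [add_comp, tr_add, Pi.add_apply, h, h', add_mul]
  | single i u =>
    rw [single_comp_single, add_zero, tr, tr]
    by_cases hi : i = 0
    · subst hi; simp
    · rw [Finsupp.single_eq_of_ne (Ne.symm hi), Finsupp.single_eq_of_ne (Ne.symm hi)]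
      simp

/-! ### Action on sequences -/

section Act

variable {m : ℕ}

lemma add_act (U V : DiffOp N) (γ : ℤ → Fin m → ℝ) : (U + V).act γ = U.act γ + V.act γ := by
  funext n
  refine Finsupp.sum_add_index' (fun i => ?_) (fun i u v => ?_)
  · simp
  · simp [add_smul]

lemma zero_act (γ : ℤ → Fin m → ℝ) : (0 : DiffOp N).act γ = 0 := by
  funext n
  simp [act]

lemma neg_act (U : DiffOp N) (γ : ℤ → Fin m → ℝ) : (-U).act γ = -U.act γ := by
  rw [eq_neg_iff_add_eq_zero, ← add_act, neg_add_cancel, zero_act]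

lemma sub_act (U V : DiffOp N) (γ : ℤ → Fin m → ℝ) : (U - V).act γ = U.act γ - V.act γ := by
  rw [sub_eq_add_neg, add_act, neg_act, sub_eq_add_neg]

lemma single_act (i : ℤ) (u : ZMod N → ℝ) (γ : ℤ → Fin m → ℝ) (n : ℤ) :
    act (Finsupp.single i u) γ n = u (n : ZMod N) • γ (n + i) := by
  unfold act
  rw [Finsupp.sum_single_index]
  simp

lemma sum_act {ι : Type*} (s : Finset ι) (f : ι → DiffOp N) (γ : ℤ → Fin m → ℝ) (n : ℤ) :
    (∑ i ∈ s, f i).act γ n = ∑ i ∈ s, (f i).act γ n := by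
  classical
  induction s using Finset.induction_on with
  | empty => simp [zero_act]
  | insert i s hi ih => rw [Finset.sum_insert hi, Finset.sum_insert hi, add_act, Pi.add_apply, ih]

lemma smul_act (c : ℝ) (U : DiffOp N) (γ : ℤ → Fin m → ℝ) : (c • U).act γ = c • U.act γ := by
  funext n
  unfold act
  rw [Finsupp.sum_smul_index' (by simp), Pi.smul_apply, Finsupp.smul_sum]
  simp [mul_smul]

lemma act_add (U : DiffOp N) (γ δ : ℤ → Fin m → ℝ) : U.act (γ + δ) = U.act γ + U.act δ := by
  funext n
  simp [act, Finsupp.sum, Finset.sum_add_distrib]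

lemma act_zero (U : DiffOp N) : U.act (0 : ℤ → Fin m → ℝ) = 0 := by
  funext n
  simp [act]

lemma comp_act (U V : DiffOp N) (γ : ℤ → Fin m → ℝ) : (U.comp V).act γ = U.act (V.act γ) := by
  induction U using Finsupp.induction_linear with
  | zero => simp only [zero_comp, zero_act]
  | add U U' h h' => simp only [add_comp, add_act, h, h']
  | single i u =>
    induction V using Finsupp.induction_linear with
    | zero => simp only [comp_zero, zero_act, act_zero]
    | add V V' h h' => simp only [comp_add, add_act, act_add, h, h']
    | single j v =>
      funext n
      rw [single_comp_single, single_act, single_act, single_act, mul_smul, add_assoc]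
      push_cast
      rfl

/-- An operator with orders between `0` and `b - 1` acts by a sum over `b` consecutive vertices. -/
lemma OrderIn.act_eq_sum {L : DiffOp N} {b : ℕ} (h : L.OrderIn 0 ((b : ℤ) - 1))
    (γ : ℤ → Fin m → ℝ) (n : ℤ) :
    L.act γ n = ∑ k : Fin b, L (k : ℤ) (n : ZMod N) • γ (n + (k : ℤ)) := by
  have hL : L = ∑ k : Fin b, Finsupp.single (k : ℤ) (L (k : ℤ)) := by
    ext1 i
    rw [Finsupp.finsetSum_apply]
    by_cases hi : 0 ≤ i ∧ i < b
    · lift i to ℕ using hi.1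
      rw [Finset.sum_eq_single (⟨i, by omega⟩ : Fin b)]
      · simp
      · intro k _ hk
        refine Finsupp.single_eq_of_ne fun h => hk ?_
        ext
        exact_mod_cast h.symm
      · simp
    · rw [h.apply_eq_zero (by omega)]
      refine (Finset.sum_eq_zero fun k _ => Finsupp.single_eq_of_ne ?_).symm
      have := k.2
      omega
  conv_lhs => rw [hL]
  rw [sum_act]
  simp only [single_act]

end Act

end DiffOp

/-! ### The companion bracket and the lifted fields in terms of operators -/

open DiffOp

section Companion

variable {N : ℕ}

lemma DiffOp.OrderIn.eq_pos_add_zero {L : DiffOp N} {b : ℤ} (h : L.OrderIn 0 b) :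
    L = L.pos + L.zero := by
  conv_lhs => rw [← L.pos_add_zero_add_neg, h.neg_eq_zero le_rfl, add_zero]

lemma DiffOp.OrderIn.eq_zero_add_neg {L : DiffOp N} {a : ℤ} (h : L.OrderIn a 0) :
    L = L.zero + L.neg := by
  conv_lhs => rw [← L.pos_add_zero_add_neg, h.pos_eq_zero le_rfl, zero_add]

/-- The operator `(P₋ D₊)₊`. For `P = δ_D F` it represents the field `r(P D) γ` modulo scalings of
the vertices of `γ`. -/
def liftOp (P D : DiffOp N) : DiffOp N := (P.neg.comp D.pos).pos

lemma liftOp_orderIn {P D : DiffOp N} {m : ℤ} (hP : P.OrderIn (-m) 0) (hD : D.OrderIn 0 m) :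
    (liftOp P D).OrderIn 1 (m - 1) :=
  ((hP.neg.comp hD.pos).mono le_rfl (by omega : -1 + m ≤ m - 1)).pos

/-- Modulo the left ideal of multiples of `D`, the product `B (Q₋ D₊)₊` is an operator of order
between `0` and `m - 1`: the multiple `(B Q₋)_{≥ 0} D` removes all terms of order at least `m`
and brings in no term of negative order. -/
lemma exists_liftOp_reduction {B Q D : DiffOp N} {m : ℤ} (hB : B.OrderIn 1 (m - 1))
    (hQ : Q.OrderIn (-m) 0) (hD : D.OrderIn 0 m) :
    ∃ S R : DiffOp N, B.comp (liftOp Q D) = S.comp D + R ∧ R.OrderIn 0 (m - 1) ∧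
      R.tr = -((B.comp Q.neg).comp D.zero).tr := by
  set S := B.comp Q.neg with hS
  set W := Q.neg.comp D.pos with hW
  have hWord : W.OrderIn (-m + 1) (m - 1) :=
    (hQ.neg.comp hD.pos).mono le_rfl (by omega)
  have hSord : S.OrderIn (1 + -m) (m - 1 + -1) := hB.comp hQ.neg
  have hC := liftOp_orderIn hQ hD
  have hW' := W.pos_add_zero_add_neg
  have hS' := S.pos_add_zero_add_neg
  have hD' := hD.eq_pos_add_zero
  have hSge : (S.pos + S.zero).OrderIn 0 (max (m - 1 + -1) 0) :=
    (hSord.pos.mono (by omega) (le_max_left _ _)).add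
      ((orderIn_zeroPart S).mono le_rfl (le_max_right _ _))
  -- `low` bounds the orders of the remainder from below, `high` (after rewriting it by `key`, where
  -- the term `B Q₋ D₊` has cancelled) from above.
  refine ⟨S.pos + S.zero, B.comp (liftOp Q D) - (S.pos + S.zero).comp D, by abel, ?_, ?_⟩
  · have low : (B.comp (liftOp Q D) - (S.pos + S.zero).comp D).OrderIn 0
        (max (m - 1 + (m - 1)) (max (m - 1 + -1) 0 + m)) :=
      ((hB.comp hC).mono (by omega) (le_max_left _ _)).sub
        ((hSge.comp hD).mono (by omega) (le_max_right _ _))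
    have key : B.comp (liftOp Q D) - (S.pos + S.zero).comp D
        = S.neg.comp D - S.comp D.zero - B.comp (W.zero + W.neg) := by
      have e1 : liftOp Q D = W - (W.zero + W.neg) := by
        rw [liftOp, ← hW, eq_sub_iff_add_eq, ← add_assoc, hW']
      have e2 : S.pos + S.zero = S - S.neg := by
        rw [eq_sub_iff_add_eq, hS']
      have e3 : B.comp W = S.comp D.pos := by rw [hW, hS, comp_assoc]
      have e4 : S.comp D = S.comp D.pos + S.comp D.zero := by
        rw [← comp_add, ← hD']
      rw [e1, e2, comp_sub, sub_comp, e3, e4]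
      abel
    have high : (S.neg.comp D - S.comp D.zero - B.comp (W.zero + W.neg)).OrderIn
        (1 + -m + -m) (m - 1) := by
      refine OrderIn.sub (OrderIn.sub ?_ ?_) ?_
      · intro i hi
        have := (hSord.neg.comp hD) i hi
        omega
      · intro i hi
        have := (hSord.comp (orderIn_zeroPart D)) i hi
        omega
      · have h1 : (W.zero + W.neg).OrderIn (min (-m + 1) 0) 0 :=
          ((orderIn_zeroPart W).mono (min_le_right _ _) le_rfl).add
            (hWord.neg.mono (min_le_left _ _) (by omega))
        intro i hi
        have := (hB.comp h1) i hi
        have h3 := min_le_left (-m + 1) 0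
        rcases le_total (-m + 1) 0 with h | h
        · rw [min_eq_left h] at this; omega
        · rw [min_eq_right h] at this; omega
    exact low.inter (key ▸ high)
  · have h1 : (B.comp (liftOp Q D)).tr = 0 := (hB.comp hC).tr_eq_zero (by omega)
    have h2 : ((S.pos + S.zero).comp D).tr = (S.comp D.zero).tr := by
      conv_lhs => rw [hD']
      rw [comp_add, tr_add, (hSge.comp hD.pos).tr_eq_zero (by omega), _root_.zero_add,
        zero_eq_single D]
      funext n
      rw [tr_comp_single_zero, tr_comp_single_zero]
      simp [tr, pos_apply, zero_apply]
    rw [tr_sub, h1, h2, zero_sub]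

/-- The companion bracket in manifestly skew-symmetric form. -/
lemma sum_tr_companion [NeZero N] {P Q D : DiffOp N} {m : ℤ} (hP : P.OrderIn (-m) 0)
    (hQ : Q.OrderIn (-m) 0) (hD : D.OrderIn 0 m) :
    ∑ n, ((D.zero.comp (P.neg.comp D.pos).pos - ((D.pos.comp P.neg).pos).comp D.zero).comp Q).tr n
      = ∑ n, (((liftOp P D).comp Q.neg).comp D.zero).tr n
        - ∑ n, (((liftOp Q D).comp P.neg).comp D.zero).tr n := by
  have hB := liftOp_orderIn hP hD
  have hZ := orderIn_zeroPart D
  have hV : (D.pos.comp P.neg).OrderIn (1 + -m) (m + -1) := hD.pos.comp hP.neg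
  have hV' := (D.pos.comp P.neg).pos_add_zero_add_neg
  set V := D.pos.comp P.neg with hVdef
  set W := Q.neg.comp D.pos with hW
  have hW' := W.pos_add_zero_add_neg
  have hWord : W.OrderIn (-m + 1) (-1 + m) := hQ.neg.comp hD.pos
  have hnonpos : ∀ (L : DiffOp N) (a b : ℤ), L.OrderIn a b →
      ∃ c, (L.zero + L.neg).OrderIn c 0 := fun L a b h =>
    ⟨min a 0, ((orderIn_zeroPart L).mono (min_le_right _ _) le_rfl).add
      (h.neg.mono (min_le_left _ _) (by omega))⟩
  -- Neither term of the bracket sees `Q₀` (`e1`, `e2`); the first then only needs cyclicity (`e3`),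
  -- and in the second the outer positive part is moved from `D₊ P₋` to `Q₋ D₊` (`e4` to `e7`).
  have e1 : ((D.zero.comp (liftOp P D)).comp Q.zero).tr = 0 :=
    ((hZ.comp hB).comp (orderIn_zeroPart Q)).tr_eq_zero (by omega)
  have e2 : ((V.pos.comp D.zero).comp Q.zero).tr = 0 :=
    ((hV.pos.comp hZ).comp (orderIn_zeroPart Q)).tr_eq_zero (by omega)
  have e3 : ∑ n, ((D.zero.comp (liftOp P D)).comp Q.neg).tr n
      = ∑ n, (((liftOp P D).comp Q.neg).comp D.zero).tr n := by
    rw [comp_assoc, sum_tr_comp_comm]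
  have e4 : ((V.pos.comp D.zero).comp Q.neg).tr = ((V.comp D.zero).comp Q.neg).tr := by
    obtain ⟨c, hc⟩ := hnonpos V _ _ hV
    conv_rhs => rw [← hV', add_assoc, add_comp, add_comp, tr_add,
      ((hc.comp hZ).comp hQ.neg).tr_eq_zero (by omega), add_zero]
  have e5 : ∑ n, ((V.comp D.zero).comp Q.neg).tr n
      = ∑ n, ((P.neg.comp D.zero).comp W).tr n := by
    rw [hVdef, hW, comp_assoc, comp_assoc, sum_tr_comp_comm]
    simp only [comp_assoc]
  have e6 : ((P.neg.comp D.zero).comp W).tr = ((P.neg.comp D.zero).comp (liftOp Q D)).tr := by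
    obtain ⟨c, hc⟩ := hnonpos W _ _ hWord
    conv_lhs => rw [← hW', add_assoc, comp_add, tr_add,
      ((hP.neg.comp hZ).comp hc).tr_eq_zero (by omega), add_zero]
    rfl
  have e7 : ∑ n, ((P.neg.comp D.zero).comp (liftOp Q D)).tr n
      = ∑ n, (((liftOp Q D).comp P.neg).comp D.zero).tr n := by
    rw [sum_tr_comp_comm]
    simp only [comp_assoc]
  have hQ' := hQ.eq_zero_add_neg
  conv_lhs => rw [hQ']
  rw [← e7, ← e6, ← e5, ← e4, ← e3, ← Finset.sum_sub_distrib]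
  refine Finset.sum_congr rfl fun n _ => ?_
  rw [show (P.neg.comp D.pos).pos = liftOp P D from rfl, comp_add, sub_comp, sub_comp, tr_add,
    tr_sub, tr_sub, e1, e2]
  simp

end Companion

section Fields

variable {N m : ℕ}

lemma opOf_orderIn (a : Coeffs N m) : (opOf a).OrderIn 0 m :=
  orderIn_sum _ _ fun k _ => (orderIn_single (k : ℤ) (a k)).mono (by positivity)
    (by have := k.2; omega)

lemma varDeriv_orderIn (F : Coeffs N m → ℝ) (a : Coeffs N m) :
    (varDeriv F a).OrderIn (-(m : ℤ)) 0 :=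
  orderIn_sum _ _ fun k _ => ((orderIn_single _ _).comp (orderIn_single _ _)).mono
    (by have := k.2; omega) (by omega)

/-- On a sequence annihilated by `D`, the operator `r(P D)` acts as `(P₋ D₊)₊` up to an operator
of order zero. -/
lemma r_comp_act {P D : DiffOp N} {b : ℤ} (hP : P.OrderIn (-b) 0) (hD : D.OrderIn 0 b)
    {γ : ℤ → Fin m → ℝ} (hγ : D.act γ = 0) :
    ∃ e : ZMod N → ℝ, (P.comp D).r.act γ = (liftOp P D + Finsupp.single 0 e).act γ := by
  set L := P.comp D with hL
  have hP' := hP.eq_zero_add_neg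
  have hD' := hD.eq_pos_add_zero
  have hLpos : L.pos = P.zero.comp D.pos + liftOp P D := by
    have : L = P.zero.comp D.pos + P.zero.comp D.zero + (P.neg.comp D.pos + P.neg.comp D.zero) := by
      rw [← comp_add, ← comp_add, ← add_comp, ← hP', ← hD']
    rw [this, pos_add, pos_add, pos_add,
      ((orderIn_zeroPart P).comp hD.pos).pos_eq_self (by omega),
      ((orderIn_zeroPart P).comp (orderIn_zeroPart D)).pos_eq_zero (by omega),
      (hP.neg.comp (orderIn_zeroPart D)).pos_eq_zero (by omega), add_zero, add_zero]
    rfl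
  have h0 : L.pos.act γ + L.zero.act γ + L.neg.act γ = 0 := by
    rw [← add_act, ← add_act, pos_add_zero_add_neg, hL, comp_act, hγ, act_zero]
  have h1 : D.pos.act γ = -D.zero.act γ := by
    rw [eq_neg_iff_add_eq_zero, ← add_act, ← hD', hγ]
  have h2 : (P.zero.comp D.pos).act γ = -(P.zero.comp D.zero).act γ := by
    rw [comp_act, comp_act, h1, eq_neg_iff_add_eq_zero, ← act_add, neg_add_cancel, act_zero]
  refine ⟨((1 / 2 : ℝ) • L.zero - P.zero.comp D.zero) 0, ?_⟩
  have h3 : Finsupp.single 0 (((1 / 2 : ℝ) • L.zero - P.zero.comp D.zero) 0)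
      = (1 / 2 : ℝ) • L.zero - P.zero.comp D.zero := by
    rw [zero_eq_single, zero_eq_single, zero_eq_single, single_comp_single, Finsupp.smul_single,
      add_zero, ← Finsupp.single_sub, Finsupp.single_eq_same]
  rw [h3, r, smul_act, sub_act, add_act, sub_act, smul_act]
  rw [hLpos, add_act, h2] at h0 ⊢
  -- Since `L γ = 0`, the negative part of `L` can be traded for the other two.
  have h4 : L.neg.act γ = (P.zero.comp D.zero).act γ - (liftOp P D).act γ - L.zero.act γ := by
    rw [← sub_eq_zero, ← h0]
    abel
  rw [h4]
  module

/-! ### Quasi-periodic sequences -/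

lemma quasiperiodic_zpow {M : GL (Fin m) ℝ} {s : ℤ → Fin m → ℝ}
    (hs : ∀ n, s (n + N) = (M : Matrix (Fin m) (Fin m) ℝ) *ᵥ s n) (k n : ℤ) :
    s (n + N * k) = ((M ^ k : GL (Fin m) ℝ) : Matrix (Fin m) (Fin m) ℝ) *ᵥ s n := by
  induction k using Int.induction_on with
  | zero => simp
  | succ k ih =>
    rw [show n + (N : ℤ) * ((k : ℤ) + 1) = n + N * k + N by ring, hs, ih, Matrix.mulVec_mulVec,
      ← Units.val_mul, ← zpow_one_add, add_comm (1 : ℤ)]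
  | pred k ih =>
    have h := hs (n + N * (-(k : ℤ) - 1))
    rw [show n + (N : ℤ) * (-(k : ℤ) - 1) + N = n + N * (-(k : ℤ)) by ring, ih] at h
    have h' := congrArg (fun v => ((M⁻¹ : GL (Fin m) ℝ) : Matrix (Fin m) (Fin m) ℝ) *ᵥ v) h
    simp only [Matrix.mulVec_mulVec, ← Units.val_mul, inv_mul_cancel, Units.val_one,
      Matrix.one_mulVec] at h'
    rw [← h', ← zpow_neg_one, ← zpow_add]
    congr 3
    ring_nf

lemma twist_zero (M : GL (Fin m) ℝ) : twist M (0 : Polygon N m) = 0 := by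
  funext n
  simp [twist]

variable [NeZero N]

/-- A sequence with `s (n + N) = M (s n)` is the twisted polygon of its first `N` values. -/
lemma twist_eq_of_quasiperiodic {M : GL (Fin m) ℝ} {s : ℤ → Fin m → ℝ}
    (hs : ∀ n, s (n + N) = (M : Matrix (Fin m) (Fin m) ℝ) *ᵥ s n) :
    twist M (fun k : ZMod N => s (k.val : ℤ)) = s := by
  funext n
  rw [twist, ZMod.val_intCast, ← quasiperiodic_zpow hs, Int.emod_add_mul_ediv]

lemma twist_add_period (M : GL (Fin m) ℝ) (p : Polygon N m) (n : ℤ) :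
    twist M p (n + N) = (M : Matrix (Fin m) (Fin m) ℝ) *ᵥ twist M p n := by
  have hN : (N : ℤ) ≠ 0 := by exact_mod_cast NeZero.ne N
  rw [twist, twist, Int.add_ediv_of_dvd_right dvd_rfl, Int.ediv_self hN, Matrix.mulVec_mulVec,
    ← Units.val_mul, ← zpow_one_add, add_comm (1 : ℤ)]
  simp

lemma act_twist_add_period (L : DiffOp N) (M : GL (Fin m) ℝ) (p : Polygon N m) (n : ℤ) :
    L.act (twist M p) (n + N) = (M : Matrix (Fin m) (Fin m) ℝ) *ᵥ L.act (twist M p) n := by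
  induction L using Finsupp.induction_linear with
  | zero => simp [zero_act]
  | add U V h h' => simp only [add_act, Pi.add_apply, h, h', Matrix.mulVec_add]
  | single i u =>
    rw [single_act, single_act, add_right_comm, twist_add_period, Matrix.mulVec_smul]
    simp

lemma twist_act (L : DiffOp N) (M : GL (Fin m) ℝ) (p : Polygon N m) :
    twist M (fun k : ZMod N => L.act (twist M p) (k.val : ℤ)) = L.act (twist M p) :=
  twist_eq_of_quasiperiodic (act_twist_add_period L M p)

/-- The operator formed from the invariants of a polygon annihilates it. By quasi-periodicity this
needs checking over one period only, where it is the definition of the invariants. -/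
lemma invariants_act (M : GL (Fin m) ℝ) (p : Polygon N m) (hp : Nondegenerate M p) :
    (opOf (invariants M p)).act (twist M p) = 0 := by
  rw [← twist_act, ← twist_zero (N := N) M]
  congr 1
  funext n
  rw [opOf, sum_act, Fin.sum_univ_castSucc]
  simp only [single_act, invariants, Fin.snoc_castSucc, Fin.snoc_last]
  have h := Matrix.mulVec_mulVec (twist M p ((n.val : ℤ) + (m : ℤ))) (rho M (n.val : ℤ) p)
    (rho M (n.val : ℤ) p)⁻¹
  rw [Matrix.mul_nonsing_inv _ (isUnit_iff_ne_zero.mpr (hp _)), Matrix.one_mulVec] at h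
  funext i
  have hi := congrFun h i
  have hn : (((n.val : ℕ) : ℤ) : ZMod N) = n := by simp
  simp only [Matrix.mulVec, dotProduct, rho, Matrix.of_apply] at hi
  simp only [Pi.add_apply, Finset.sum_apply, Pi.smul_apply, smul_eq_mul, hn, Fin.val_castSucc,
    Fin.val_last, Pi.zero_apply]
  rw [← hi, neg_one_mul, add_neg_eq_zero]
  refine Finset.sum_congr rfl fun k _ => ?_
  rw [mul_comm]
  rfl

lemma twist_hamField (M : GL (Fin m) ℝ) (F : Coeffs N m → ℝ) (p : Polygon N m) :
    twist M (hamField M F p)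
      = (((varDeriv F (invariants M p)).comp (opOf (invariants M p))).r).act (twist M p) :=
  twist_act _ M p

/-- `X^f` lifts the Hamiltonian evolution of `D`. -/
lemma opOf_act_hamField (M : GL (Fin m) ℝ) (F : Coeffs N m → ℝ) (p : Polygon N m)
    (hp : Nondegenerate M p) (n : ℤ) :
    (opOf (invariants M p)).act (twist M (hamField M F p)) n
      = - (hamOp F (invariants M p)).act (twist M p) n := by
  rw [twist_hamField, hamOp, sub_act, comp_act, comp_act, invariants_act M p hp, act_zero,
    zero_sub, Pi.neg_apply, neg_neg]

end Fields

/-! ### Determinants of frames -/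

/-- A two-column minor formula: replacing column `i` of a frame by a combination of the frame and
column `j` by `w`. Only the `i`-th and `j`-th coefficients of the combination matter, the latter
with a sign from swapping the two columns. -/
lemma alternating_update_update {ι E : Type*} [Fintype ι] [DecidableEq ι] [AddCommGroup E]
    [Module ℝ E] (A : E [⋀^ι]→ₗ[ℝ] ℝ) (f : ι → E) (c : ι → ℝ) (w : E) {i j : ι} (hij : i ≠ j) :
    A (Function.update (Function.update f j w) i (∑ k, c k • f k))
      = c i * A (Function.update f j w) - c j * A (Function.update f i w) := by
  have hswap : Function.update (Function.update f j w) i (f j)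
      = Function.update f i w ∘ Equiv.swap i j := by
    funext k
    by_cases hi : k = i
    · subst hi
      simp [Function.update_of_ne hij.symm]
    · by_cases hj : k = j
      · subst hj
        simp [Function.update_of_ne hij.symm]
      · simp [hi, hj, Equiv.swap_apply_of_ne_of_ne hi hj]
  rw [A.map_update_sum, Fintype.sum_eq_add i j hij]
  · rw [A.map_update_smul, A.map_update_smul, hswap, A.map_swap _ hij]
    have : Function.update (Function.update f j w) i (f i) = Function.update f j w := by
      rw [Function.update_eq_self_iff, Function.update_of_ne hij]
    rw [this]
    simp only [smul_eq_mul]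
    ring
  · rintro k ⟨hki, hkj⟩
    rw [A.map_update_smul, A.map_eq_zero_of_eq _ (i := i) (j := k) _ hki.symm, smul_zero]
    rw [Function.update_self, Function.update_of_ne hki, Function.update_of_ne hkj]

lemma alternating_update_sum {ι E : Type*} [Fintype ι] [DecidableEq ι] [AddCommGroup E]
    [Module ℝ E] (A : E [⋀^ι]→ₗ[ℝ] ℝ) (f : ι → E) (c : ι → ℝ) (i : ι) :
    A (Function.update f i (∑ k, c k • f k)) = c i * A f := by
  rw [A.map_update_sum, Fintype.sum_eq_single i]
  · rw [A.map_update_smul, Function.update_eq_self, smul_eq_mul]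
  · intro k hk
    rw [A.map_update_smul, A.map_update_self _ hk.symm, smul_zero]

/-- The determinant as a continuous alternating map of the columns. -/
def colDet (m : ℕ) : (Fin m → ℝ) [⋀^Fin m]→L[ℝ] ℝ :=
  { (Matrix.detRowAlternating : (Fin m → ℝ) [⋀^Fin m]→ₗ[ℝ] ℝ) with
    cont := Continuous.matrix_det (A := fun c : Fin m → Fin m → ℝ => Matrix.of c)
      continuous_id }

section Frames

variable {N m : ℕ}

/-- The vectors `γ n, …, γ (n + m - 1)`. -/
def frame (M : GL (Fin m) ℝ) (n : ℤ) (p : Polygon N m) (j : Fin m) : Fin m → ℝ :=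
  twist M p (n + (j : ℤ))

lemma dd_eq (M : GL (Fin m) ℝ) (n : ℤ) (p : Polygon N m) :
    dd M n p = colDet m (frame M n p) := by
  rw [dd, ← Matrix.det_transpose]
  rfl

lemma theta_eq [NeZero m] (M : GL (Fin m) ℝ) (n : ℤ) (p X : Polygon N m) :
    theta M n p X = colDet m (Function.update (frame M n p) 0 (twist M X n)) := by
  change ((rho M n p).updateCol 0 (twist M X n)).det = _
  rw [← Matrix.det_transpose, ← Matrix.updateRow_transpose]
  rfl

/-- The derivative of the one-form `θ n` in the direction `y`, evaluated on `x`: the sum over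
`j ≠ 0` of the determinants in which `γ n` is replaced by `x n` and `γ (n + j)` by `y (n + j)`. -/
def thetaDeriv [NeZero m] (M : GL (Fin m) ℝ) (n : ℤ) (p x y : Polygon N m) : ℝ :=
  ∑ j ∈ Finset.univ.erase 0, colDet m
    (Function.update (Function.update (frame M n p) j (frame M n y j)) 0 (twist M x n))

variable [NeZero N]

/-- `p ↦ γ n` as a continuous linear map. -/
def twistCLM (N : ℕ) [NeZero N] {m : ℕ} (M : GL (Fin m) ℝ) (n : ℤ) :
    Polygon N m →L[ℝ] (Fin m → ℝ) :=
  LinearMap.toContinuousLinearMap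
    { toFun := fun p => twist M p n
      map_add' := fun X Y => by simp only [twist, Pi.add_apply, Matrix.mulVec_add]
      map_smul' := fun c X => by
        simp only [twist, Pi.smul_apply, Matrix.mulVec_smul, RingHom.id_apply] }

lemma hasFDerivAt_colDet {E : Type*} [NormedAddCommGroup E] [NormedSpace ℝ E]
    {c : E → Fin m → Fin m → ℝ} {c' : Fin m → E →L[ℝ] (Fin m → ℝ)} {p : E}
    (hc : ∀ j, HasFDerivAt (fun q => c q j) (c' j) p) :
    HasFDerivAt (fun q => colDet m (c q))
      (((colDet m).1.linearDeriv (c p)).comp (ContinuousLinearMap.pi c')) p :=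
  ((colDet m).hasFDerivAt (c p)).comp p (hasFDerivAt_pi.mpr hc)

lemma fderiv_colDet {E : Type*} [NormedAddCommGroup E] [NormedSpace ℝ E]
    {c : E → Fin m → Fin m → ℝ} {c' : Fin m → E →L[ℝ] (Fin m → ℝ)} {p : E}
    (hc : ∀ j, HasFDerivAt (fun q => c q j) (c' j) p) (v : E) :
    fderiv ℝ (fun q => colDet m (c q)) p v
      = ∑ j, colDet m (Function.update (c p) j (c' j v)) := by
  rw [(hasFDerivAt_colDet hc).fderiv, ContinuousLinearMap.comp_apply,
    ContinuousMultilinearMap.linearDeriv_apply]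
  rfl

lemma hasFDerivAt_frame (M : GL (Fin m) ℝ) (n : ℤ) (p : Polygon N m) (j : Fin m) :
    HasFDerivAt (fun q => frame M n q j) (twistCLM N M (n + (j : ℤ))) p :=
  (twistCLM N M (n + (j : ℤ))).hasFDerivAt

lemma differentiableAt_dd (M : GL (Fin m) ℝ) (n : ℤ) (p : Polygon N m) :
    DifferentiableAt ℝ (dd M n) p := by
  rw [funext (dd_eq M n)]
  exact (hasFDerivAt_colDet (hasFDerivAt_frame M n p)).differentiableAt

lemma fderiv_dd (M : GL (Fin m) ℝ) (n : ℤ) (p v : Polygon N m) :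
    fderiv ℝ (dd M n) p v
      = ∑ j, colDet m (Function.update (frame M n p) j (frame M n v j)) := by
  rw [funext (dd_eq M n), fderiv_colDet (hasFDerivAt_frame M n p)]
  rfl

variable [NeZero m]

lemma hasFDerivAt_theta_frame (M : GL (Fin m) ℝ) (n : ℤ) {X : Polygon N m → Polygon N m}
    {p : Polygon N m} (hX : DifferentiableAt ℝ X p) (j : Fin m) :
    HasFDerivAt (fun q => Function.update (frame M n q) 0 (twist M (X q) n) j)
      (if j = 0 then (twistCLM N M n).comp (fderiv ℝ X p) else twistCLM N M (n + (j : ℤ))) p := by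
  by_cases hj : j = 0
  · subst hj
    simp only [Function.update_self, if_true]
    exact (twistCLM N M n).hasFDerivAt.comp p hX.hasFDerivAt
  · simp only [Function.update_of_ne hj, if_neg hj]
    exact hasFDerivAt_frame M n p j

lemma differentiableAt_theta (M : GL (Fin m) ℝ) (n : ℤ) {X : Polygon N m → Polygon N m}
    {p : Polygon N m} (hX : DifferentiableAt ℝ X p) :
    DifferentiableAt ℝ (fun q => theta M n q (X q)) p := by
  simp only [theta_eq]
  exact (hasFDerivAt_colDet (hasFDerivAt_theta_frame M n hX)).differentiableAt

lemma fderiv_theta (M : GL (Fin m) ℝ) (n : ℤ) {X : Polygon N m → Polygon N m}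
    {p : Polygon N m} (hX : DifferentiableAt ℝ X p) (v : Polygon N m) :
    fderiv ℝ (fun q => theta M n q (X q)) p v
      = theta M n p (fderiv ℝ X p v) + thetaDeriv M n p (X p) v := by
  simp only [theta_eq]
  rw [fderiv_colDet (hasFDerivAt_theta_frame M n hX), thetaDeriv,
    ← Finset.add_sum_erase _ _ (Finset.mem_univ (0 : Fin m))]
  congr 1
  · rw [if_pos rfl, Function.update_idem]
    rfl
  · refine Finset.sum_congr rfl fun j hj => ?_
    have hj := Finset.ne_of_mem_erase hj
    rw [if_neg hj, Function.update_comm hj]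
    rfl

/-- The form `ω₂` depends on the values of the two vector fields only. -/
lemma omega₂_eq (M : GL (Fin m) ℝ) {X Y : Polygon N m → Polygon N m} {p : Polygon N m}
    (hX : DifferentiableAt ℝ X p) (hY : DifferentiableAt ℝ Y p) :
    omega₂ M X Y p = ∑ n ∈ Finset.range N, 1 / dd M (n : ℤ) p *
      (thetaDeriv M n p (X p) (Y p) - thetaDeriv M n p (Y p) (X p)
        + 1 / dd M (n : ℤ) p *
          (theta M (n : ℤ) p (Y p) * fderiv ℝ (dd M (n : ℤ)) p (X p)
            - theta M (n : ℤ) p (X p) * fderiv ℝ (dd M (n : ℤ)) p (Y p))) := by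
  refine Finset.sum_congr rfl fun n _ => ?_
  rw [fderiv_theta M n hX, fderiv_theta M n hY, VectorField.lieBracket, map_sub]
  ring

/-! ### The potential of `ω₂` -/

lemma thetaForm_apply (M : GL (Fin m) ℝ) (p : Polygon N m) (v : Fin 1 → Polygon N m) :
    thetaForm M p v = ∑ n ∈ Finset.range N, 1 / dd M (n : ℤ) p * theta M (n : ℤ) p (v 0) := by
  simp [thetaForm]

lemma hasFDerivAt_theta_div (M : GL (Fin m) ℝ) {p : Polygon N m} (hp : Nondegenerate M p)
    (n : ℤ) (x : Polygon N m) :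
    HasFDerivAt (fun q => 1 / dd M n q * theta M n q x)
      ((1 / dd M n p) • fderiv ℝ (fun q => theta M n q x) p
        + theta M n p x • (-(dd M n p ^ 2)⁻¹ • fderiv ℝ (dd M n) p)) p := by
  simp only [one_div]
  exact ((hasDerivAt_inv (hp n)).comp_hasFDerivAt p (differentiableAt_dd M n p).hasFDerivAt).mul
    (differentiableAt_theta M n (differentiableAt_const x)).hasFDerivAt

/-- The form `∑ n, θ n / 𝐝 n` is differentiable as a map into alternating forms: it is expanded in
the coordinate forms, whose coefficients are its values on constant fields. -/
lemma differentiableAt_thetaForm (M : GL (Fin m) ℝ) {p : Polygon N m} (hp : Nondegenerate M p) :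
    DifferentiableAt ℝ (thetaForm M) p := by
  have hform : thetaForm (N := N) M = fun q => ∑ k : ZMod N, ∑ i : Fin m,
      (∑ n ∈ Finset.range N, 1 / dd M (n : ℤ) q *
        theta M (n : ℤ) q (Pi.single k (Pi.single i 1))) •
      ContinuousAlternatingMap.ofSubsingleton ℝ (Polygon N m) ℝ (0 : Fin 1)
        ((ContinuousLinearMap.proj i : (Fin m → ℝ) →L[ℝ] ℝ).comp (ContinuousLinearMap.proj k)) := by
    funext q
    ext v
    have hv : v 0 = ∑ k : ZMod N, ∑ i : Fin m, v 0 k i • Pi.single k (Pi.single i (1 : ℝ)) := by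
      funext k i
      simp [Finset.sum_apply, Pi.single_apply, ite_apply, apply_ite]
    rw [thetaForm_apply]
    conv_lhs => rw [hv]
    simp only [map_sum, map_smul, smul_eq_mul, Finset.mul_sum]
    rw [Finset.sum_comm]
    simp only [ContinuousAlternatingMap.sum_apply, ContinuousAlternatingMap.smul_apply]
    refine Finset.sum_congr rfl fun k _ => ?_
    rw [Finset.sum_comm]
    refine Finset.sum_congr rfl fun i _ => ?_
    simp [Finset.sum_mul]
    refine Finset.sum_congr rfl fun n _ => ?_
    ring
  rw [hform]
  refine DifferentiableAt.fun_sum fun k _ => DifferentiableAt.fun_sum fun i _ => ?_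
  refine DifferentiableAt.smul_const (DifferentiableAt.fun_sum fun n _ => ?_) _
  exact (hasFDerivAt_theta_div M hp n _).differentiableAt

lemma fderiv_thetaForm_apply (M : GL (Fin m) ℝ) {p : Polygon N m} (hp : Nondegenerate M p)
    (x : Fin 1 → Polygon N m) (y : Polygon N m) :
    fderiv ℝ (fun q => thetaForm M q x) p y = ∑ n ∈ Finset.range N, 1 / dd M (n : ℤ) p *
      (thetaDeriv M n p (x 0) y
        - 1 / dd M (n : ℤ) p * (theta M n p (x 0) * fderiv ℝ (dd M (n : ℤ)) p y)) := by
  simp only [thetaForm_apply]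
  rw [(HasFDerivAt.fun_sum (u := Finset.range N)
    fun (n : ℕ) _ => hasFDerivAt_theta_div M hp (n : ℤ) (x 0)).fderiv]
  rw [_root_.sum_apply]
  refine Finset.sum_congr rfl fun n _ => ?_
  have h := fderiv_theta M n (differentiableAt_const (x := p) (x 0)) y
  rw [fderiv_const_apply] at h
  simp only [_root_.add_apply, _root_.smul_apply, h, smul_eq_mul,
    _root_.zero_apply, map_zero]
  have hd := hp n
  field_simp
  ring

lemma omega₂_eq_extDeriv (M : GL (Fin m) ℝ) {X Y : Polygon N m → Polygon N m} {p : Polygon N m}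
    (hp : Nondegenerate M p) (hX : DifferentiableAt ℝ X p) (hY : DifferentiableAt ℝ Y p) :
    omega₂ M X Y p = extDeriv (thetaForm M) p ![Y p, X p] := by
  rw [extDeriv_apply (differentiableAt_thetaForm M hp), Fin.sum_univ_two,
    fderiv_thetaForm_apply M hp, fderiv_thetaForm_apply M hp, omega₂_eq M hX hY]
  simp only [Fin.val_zero, pow_zero, one_smul, Fin.val_one, pow_one, neg_smul]
  rw [← sub_eq_add_neg, ← Finset.sum_sub_distrib]
  refine Finset.sum_congr rfl fun n _ => ?_
  simp only [Fin.removeNth, Fin.succAbove, Matrix.cons_val_zero, Matrix.cons_val_one]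
  simp
  ring

end Frames

/-! ### Differentiability of the Hamiltonian vector fields -/

section Smooth

variable {N m : ℕ}

lemma DiffOp.sum_comp {ι : Type*} (s : Finset ι) (f : ι → DiffOp N) (V : DiffOp N) :
    DiffOp.comp (∑ i ∈ s, f i) V = ∑ i ∈ s, (f i).comp V := by
  classical
  induction s using Finset.induction_on with
  | empty => simp [zero_comp]
  | insert i s hi ih => rw [Finset.sum_insert hi, Finset.sum_insert hi, add_comp, ih]

lemma DiffOp.comp_sum {ι : Type*} (s : Finset ι) (f : ι → DiffOp N) (U : DiffOp N) :
    DiffOp.comp U (∑ i ∈ s, f i) = ∑ i ∈ s, U.comp (f i) := by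
  classical
  induction s using Finset.induction_on with
  | empty => simp [comp_zero]
  | insert i s hi ih => rw [Finset.sum_insert hi, Finset.sum_insert hi, comp_add, ih]

lemma DiffOp.r_sum {ι : Type*} (s : Finset ι) (f : ι → DiffOp N) :
    DiffOp.r (∑ i ∈ s, f i) = ∑ i ∈ s, (f i).r := by
  classical
  induction s using Finset.induction_on with
  | empty =>
    ext1 i
    simp [DiffOp.r, pos_apply, neg_apply]
  | insert i s hi ih =>
    rw [Finset.sum_insert hi, Finset.sum_insert hi, ← ih, DiffOp.r, DiffOp.r, DiffOp.r, pos_add,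
      neg_add]
    module

lemma DiffOp.r_single (i : ℤ) (u : ZMod N → ℝ) :
    DiffOp.r (Finsupp.single i u) = Finsupp.single i (((i.sign : ℝ) / 2) • u) := by
  rw [DiffOp.r, DiffOp.pos, DiffOp.neg]
  rcases lt_trichotomy i 0 with h | h | h
  · rw [Finsupp.filter_single_of_neg _ h.le.not_gt,
      Finsupp.filter_single_of_pos (fun j : ℤ => j < 0) h, zero_sub,
      smul_neg, Finsupp.smul_single, ← Finsupp.single_neg, Int.sign_eq_neg_one_of_neg h]
    congr 1
    push_cast
    module
  · subst h
    rw [Finsupp.filter_single_of_neg _ (lt_irrefl _),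
      Finsupp.filter_single_of_neg (fun j : ℤ => j < 0) (lt_irrefl _)]
    simp
  · rw [Finsupp.filter_single_of_pos _ h,
      Finsupp.filter_single_of_neg (fun j : ℤ => j < 0) h.le.not_gt, sub_zero,
      Finsupp.smul_single, Int.sign_eq_one_of_pos h]
    simp

/-- Cramer's rule for coordinates in the basis `ρ n`. -/
lemma inv_rho_mulVec (M : GL (Fin m) ℝ) (n : ℤ) (p : Polygon N m) (v : Fin m → ℝ) (k : Fin m) :
    ((rho M n p)⁻¹ *ᵥ v) k = (dd M n p)⁻¹ * colDet m (Function.update (frame M n p) k v) := by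
  rw [Matrix.inv_def, Matrix.smul_mulVec, ← Matrix.cramer_eq_adjugate_mulVec, Pi.smul_apply,
    Matrix.cramer_apply, smul_eq_mul, Ring.inverse_eq_inv', ← Matrix.det_transpose
      ((rho M n p).updateCol k v), ← Matrix.updateRow_transpose]
  rfl

variable [NeZero N]

/-- An expression for the Hamiltonian field with a fixed index set: the supports of the operators
in its definition vary with the polygon, which hides its smoothness. -/
lemma hamField_eq_sum (M : GL (Fin m) ℝ) (F : Coeffs N m → ℝ) (p : Polygon N m) (n : ZMod N) :
    hamField M F p n = ∑ k : Fin (m + 1), ∑ l : Fin (m + 1),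
      (((-(k : ℤ) + (l : ℤ)).sign : ℝ) / 2 *
        (partialVar F (invariants M p) k (n - (k : ZMod N)) *
          invariants M p l (n - (k : ZMod N)))) •
      twist M p ((n.val : ℤ) + (-(k : ℤ) + (l : ℤ))) := by
  rw [hamField, varDeriv, opOf, DiffOp.sum_comp, r_sum, sum_act]
  refine Finset.sum_congr rfl fun k _ => ?_
  rw [DiffOp.comp_sum, r_sum, sum_act]
  refine Finset.sum_congr rfl fun l _ => ?_
  rw [single_comp_single, single_comp_single, r_single, single_act, add_zero]
  simp [sub_eq_add_neg]

lemma differentiableAt_invariants (M : GL (Fin m) ℝ) {p : Polygon N m} (hp : Nondegenerate M p) :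
    DifferentiableAt ℝ (invariants M) p := by
  refine differentiableAt_pi.mpr fun k => differentiableAt_pi.mpr fun n => ?_
  induction k using Fin.lastCases with
  | last =>
    simp only [invariants, Fin.snoc_last]
    exact differentiableAt_const _
  | cast k =>
    simp only [invariants, Fin.snoc_castSucc, inv_rho_mulVec]
    refine ((differentiableAt_dd M _ p).inv (hp _)).mul (HasFDerivAt.differentiableAt
      (hasFDerivAt_colDet (c' := fun j => if j = k then twistCLM N M ((n.val : ℤ) + (m : ℤ))
        else twistCLM N M ((n.val : ℤ) + (j : ℤ))) fun j => ?_))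
    by_cases hj : j = k
    · subst hj
      simp only [Function.update_self, if_true]
      exact (twistCLM N M _).hasFDerivAt
    · simp only [Function.update_of_ne hj, if_neg hj]
      exact hasFDerivAt_frame M _ p j

lemma differentiableAt_hamField (M : GL (Fin m) ℝ) {F : Coeffs N m → ℝ} {p : Polygon N m}
    (hp : Nondegenerate M p) (hF : ContDiffAt ℝ 2 F (invariants M p)) :
    DifferentiableAt ℝ (hamField M F) p := by
  have ha := differentiableAt_invariants M hp
  have hF' : DifferentiableAt ℝ (fun q => fderiv ℝ F (invariants M q)) p :=
    ((hF.fderiv_right (m := 1) (by norm_num)).differentiableAt (by norm_num)).comp p ha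
  refine differentiableAt_pi.mpr fun n => ?_
  simp only [hamField_eq_sum, partialVar]
  refine DifferentiableAt.fun_sum fun k _ => DifferentiableAt.fun_sum fun l _ => ?_
  have h : DifferentiableAt ℝ (fun q => fderiv ℝ F (invariants M q)
      (Pi.single k (Pi.single (n - (k : ZMod N)) 1))) p :=
    hF'.clm_apply (differentiableAt_const _)
  have h' : DifferentiableAt ℝ (fun q => invariants M q l (n - (k : ZMod N))) p :=
    differentiableAt_pi.mp (differentiableAt_pi.mp ha l) _
  exact ((h.mul h').const_mul _).smul (twistCLM N M _).differentiableAt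

end Smooth

/-! ### `ω₂` on fields given by operators -/

section Bracket

variable {N m : ℕ} [NeZero m]

/-- If `L` has orders between `0` and `m - 1`, the coordinate of `(L γ) n` along `γ n` in the basis
`γ n, …, γ (n + m - 1)` is the trace of `L`. -/
lemma colDet_update_act {L : DiffOp N} (hL : L.OrderIn 0 ((m : ℤ) - 1)) (M : GL (Fin m) ℝ)
    (p : Polygon N m) (n : ℤ) :
    colDet m (Function.update (frame M n p) 0 (L.act (twist M p) n))
      = L.tr (n : ZMod N) * dd M n p := by
  rw [hL.act_eq_sum, dd_eq]
  have := alternating_update_sum (colDet m).toAlternatingMap (frame M n p)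
    (fun k : Fin m => L (k : ℤ) (n : ZMod N)) 0
  simpa [tr, frame] using this

/-- The coordinate along `γ n` when the product of two lifting operators, each corrected by a term
of order zero, is applied to `γ`. -/
lemma colDet_update_liftOp {P Q D : DiffOp N} (hP : P.OrderIn (-(m : ℤ)) 0)
    (hQ : Q.OrderIn (-(m : ℤ)) 0) (hD : D.OrderIn 0 m) (M : GL (Fin m) ℝ) (p : Polygon N m)
    (hDp : D.act (twist M p) = 0) (e f : ZMod N → ℝ) (n : ℤ) :
    colDet m (Function.update (frame M n p) 0
        (((liftOp P D + Finsupp.single 0 e).comp (liftOp Q D + Finsupp.single 0 f)).act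
          (twist M p) n))
      = (e (n : ZMod N) * f (n : ZMod N)
          - (((liftOp P D).comp Q.neg).comp D.zero).tr (n : ZMod N)) * dd M n p := by
  obtain ⟨S, R, hR, hRord, hRtr⟩ := exists_liftOp_reduction (liftOp_orderIn hP hD) hQ hD
  have hm : (1 : ℤ) ≤ m := by exact_mod_cast NeZero.one_le
  have hB := liftOp_orderIn hP hD
  have hC := liftOp_orderIn hQ hD
  have o1 : ((liftOp P D).comp (Finsupp.single 0 f)).OrderIn 1 ((m : ℤ) - 1) :=
    (hB.comp (orderIn_single 0 f)).mono (by omega) (by omega)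
  have o2 : (DiffOp.comp (Finsupp.single 0 e) (liftOp Q D)).OrderIn 1 ((m : ℤ) - 1) :=
    ((orderIn_single 0 e).comp hC).mono (by omega) (by omega)
  have o3 : (DiffOp.comp (Finsupp.single 0 e : DiffOp N) (Finsupp.single 0 f)).OrderIn 0 0 :=
    (orderIn_single 0 e).comp (orderIn_single 0 f)
  have hact : ((liftOp P D + Finsupp.single 0 e).comp (liftOp Q D + Finsupp.single 0 f)).act
      (twist M p) = (R + (liftOp P D).comp (Finsupp.single 0 f)
        + (DiffOp.comp (Finsupp.single 0 e) (liftOp Q D)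
          + DiffOp.comp (Finsupp.single 0 e : DiffOp N) (Finsupp.single 0 f))).act
        (twist M p) := by
    rw [add_comp, comp_add, comp_add, hR]
    simp only [add_act]
    rw [comp_act S, hDp, act_zero, zero_add]
  rw [hact, colDet_update_act]
  · congr 1
    rw [tr_add, tr_add, tr_add, o1.tr_eq_zero (by omega), o2.tr_eq_zero (by omega), hRtr]
    simp only [Pi.add_apply, Pi.neg_apply, Pi.zero_apply, tr_comp_single_zero]
    simp only [tr, Finsupp.single_eq_same]
    ring
  · exact (hRord.add (o1.mono (by omega) le_rfl)).add
      ((o2.mono (by omega) le_rfl).add (o3.mono le_rfl (by omega)))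

variable [NeZero N]

/-- For a field `x = L γ`, Cramer's rule reduces `thetaDeriv` to one-column determinants. -/
lemma thetaDeriv_eq {L : DiffOp N} (hL : L.OrderIn 0 ((m : ℤ) - 1)) (M : GL (Fin m) ℝ)
    (p x y : Polygon N m) (n : ℤ) (hx : twist M x = L.act (twist M p)) :
    thetaDeriv M n p x y = L.tr (n : ZMod N) * fderiv ℝ (dd M n) p y
      - colDet m (Function.update (frame M n p) 0 (L.act (twist M y) n)) := by
  have h0 : ∀ j ∈ Finset.univ.erase (0 : Fin m), colDet m
      (Function.update (Function.update (frame M n p) j (frame M n y j)) 0 (twist M x n))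
      = L 0 (n : ZMod N) * colDet m (Function.update (frame M n p) j (frame M n y j))
        - L (j : ℤ) (n : ZMod N) * colDet m (Function.update (frame M n p) 0 (frame M n y j)) := by
    intro j hj
    have := alternating_update_update (colDet m).toAlternatingMap (frame M n p)
      (fun k : Fin m => L (k : ℤ) (n : ZMod N)) (frame M n y j) (Finset.ne_of_mem_erase hj).symm
    rw [hx, hL.act_eq_sum]
    simpa [frame] using this
  have h1 : colDet m (Function.update (frame M n p) 0 (L.act (twist M y) n))
      = ∑ j : Fin m, L (j : ℤ) (n : ZMod N) *
        colDet m (Function.update (frame M n p) 0 (frame M n y j)) := by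
    rw [hL.act_eq_sum]
    have := (colDet m).toAlternatingMap.map_update_sum Finset.univ 0
      (fun j : Fin m => L (j : ℤ) (n : ZMod N) • frame M n y j) (frame M n p)
    simpa [frame] using this
  rw [thetaDeriv, Finset.sum_congr rfl h0, h1, fderiv_dd, Finset.mul_sum,
    Finset.sum_sub_distrib, ← Finset.add_sum_erase _ _ (Finset.mem_univ (0 : Fin m)),
    ← Finset.add_sum_erase Finset.univ (fun j : Fin m => L (j : ℤ) (n : ZMod N) *
        colDet m (Function.update (frame M n p) 0 (frame M n y j))) (Finset.mem_univ (0 : Fin m))]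
  simp [tr]

/-- The form `ω₂` on two fields `U γ` and `V γ`, where `U` and `V` have orders between `0` and
`m - 1`: each summand is the coordinate of `((V U - U V) γ) n` along `γ n`. -/
lemma omega₂_act (M : GL (Fin m) ℝ) {X Y : Polygon N m → Polygon N m} {p : Polygon N m}
    (hp : Nondegenerate M p) (hX : DifferentiableAt ℝ X p) (hY : DifferentiableAt ℝ Y p)
    {U V : DiffOp N} (hU : U.OrderIn 0 ((m : ℤ) - 1)) (hV : V.OrderIn 0 ((m : ℤ) - 1))
    (hXU : twist M (X p) = U.act (twist M p)) (hYV : twist M (Y p) = V.act (twist M p)) :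
    omega₂ M X Y p = ∑ n ∈ Finset.range N, 1 / dd M (n : ℤ) p *
      (colDet m (Function.update (frame M n p) 0 ((V.comp U).act (twist M p) n))
        - colDet m (Function.update (frame M n p) 0 ((U.comp V).act (twist M p) n))) := by
  rw [omega₂_eq M hX hY]
  refine Finset.sum_congr rfl fun n _ => ?_
  have hd := hp n
  have hθX : theta M n p (X p) = U.tr ((n : ℤ) : ZMod N) * dd M n p := by
    rw [theta_eq, hXU, colDet_update_act hU]
  have hθY : theta M n p (Y p) = V.tr ((n : ℤ) : ZMod N) * dd M n p := by
    rw [theta_eq, hYV, colDet_update_act hV]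
  rw [thetaDeriv_eq hU M p _ _ n hXU, thetaDeriv_eq hV M p _ _ n hYV, hθX, hθY,
    comp_act, comp_act, ← hXU, ← hYV]
  field_simp
  ring

lemma sum_range_intCast (f : ZMod N → ℝ) :
    ∑ n ∈ Finset.range N, f (((n : ℕ) : ℤ) : ZMod N) = ∑ n, f n := by
  refine Finset.sum_bij' (fun n _ => ((n : ℕ) : ZMod N)) (fun n _ => n.val) ?_ ?_ ?_ ?_ ?_
  · simp
  · intro n _
    simpa using n.val_lt
  · intro n hn
    exact ZMod.val_cast_of_lt (Finset.mem_range.mp hn)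
  · simp
  · simp

/-- The companion bracket is minus `ω₂` on the lifted fields: the scalings separating the lifted
fields from `(P₋ D₊)₊ γ` and `(Q₋ D₊)₊ γ` enter both orders of composition alike. -/
lemma bracket₂_eq_neg_omega₂ (M : GL (Fin m) ℝ) {p : Polygon N m} (hp : Nondegenerate M p)
    {F G : Coeffs N m → ℝ} (hF : ContDiffAt ℝ 2 F (invariants M p))
    (hG : ContDiffAt ℝ 2 G (invariants M p)) :
    bracket₂ F G (invariants M p) = -omega₂ M (hamField M G) (hamField M F) p := by
  have hD := opOf_orderIn (invariants M p)
  have hP := varDeriv_orderIn F (invariants M p)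
  have hQ := varDeriv_orderIn G (invariants M p)
  have hDp := invariants_act M p hp
  have hm : (1 : ℤ) ≤ m := by exact_mod_cast NeZero.one_le
  obtain ⟨e, he⟩ := r_comp_act hP hD hDp
  obtain ⟨f, hf⟩ := r_comp_act hQ hD hDp
  have hU := ((liftOp_orderIn hP hD).mono zero_le_one le_rfl).add
    ((orderIn_single 0 e).mono le_rfl (by omega))
  have hV := ((liftOp_orderIn hQ hD).mono zero_le_one le_rfl).add
    ((orderIn_single 0 f).mono le_rfl (by omega))
  rw [bracket₂, sum_tr_companion hP hQ hD,
    omega₂_act M hp (differentiableAt_hamField M hp hG) (differentiableAt_hamField M hp hF) hV hU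
      ((twist_hamField M G p).trans hf) ((twist_hamField M F p).trans he),
    ← sum_range_intCast, ← sum_range_intCast, ← Finset.sum_sub_distrib, ← Finset.sum_neg_distrib]
  refine Finset.sum_congr rfl fun n _ => ?_
  rw [colDet_update_liftOp hP hQ hD M p hDp, colDet_update_liftOp hQ hP hD M p hDp]
  have hd := hp n
  field_simp
  ring

end Bracket

end DiscreteW

end

theorem mainTheorem2 (N m : ℕ) [NeZero N] [NeZero m] (hNm : N.Coprime m)
    (M : GL (Fin m) ℝ) (p : DiscreteW.Polygon N m) (hp : DiscreteW.Nondegenerate M p) :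
    (∀ X Y : DiscreteW.Polygon N m → DiscreteW.Polygon N m,
      DifferentiableAt ℝ X p → DifferentiableAt ℝ Y p →
        DiscreteW.omega₂ M X Y p = extDeriv (DiscreteW.thetaForm M) p ![Y p, X p]) ∧
    ∀ F G : DiscreteW.Coeffs N m → ℝ,
      ContDiffAt ℝ 2 F (DiscreteW.invariants M p) →
      ContDiffAt ℝ 2 G (DiscreteW.invariants M p) →
        (∀ n : ℤ,
          (DiscreteW.opOf (DiscreteW.invariants M p)).act
              (DiscreteW.twist M (DiscreteW.hamField M F p)) n
            = - (DiscreteW.hamOp F (DiscreteW.invariants M p)).act (DiscreteW.twist M p) n) ∧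
        DiscreteW.bracket₂ F G (DiscreteW.invariants M p)
          = - DiscreteW.omega₂ M (DiscreteW.hamField M G) (DiscreteW.hamField M F) p := by
  refine ⟨fun X Y hX hY => DiscreteW.omega₂_eq_extDeriv M hp hX hY, fun F G hF hG => ⟨?_, ?_⟩⟩
  · exact DiscreteW.opOf_act_hamField M F p hp
  · exact DiscreteW.bracket₂_eq_neg_omega₂ M hp hF hG
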